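/- A group $G$ is a \emph{$J$-group} if there are $k\in G$ and a function $f\colon G\to G$ with $f(xk)=xf(x)$ for all $x\in G$. An element $k\in G$ of finite order $n=|k|$ is a \emph{witness} for $G$ if $xk^{n-1}\cdot xk^{n-2}\cdots xk\cdot x=1$ for all $x\in G$; let $\mathcal W(G)$ be the set of witnesses. Let $\mathcal B(G)=\{x\in G : |x|=\exp(G)\}$, and let $\gamma_1(G)=G$, $\gamma_{i+1}(G)=[\gamma_i(G),G]$ be the lower central series. (1) Let $p>2$ be a prime and let $G$ be a finite $p$-group of nilpotency class at most $6$. Then $G$ is a $J$-group. If moreover $G\ne 1$, then there is a largest integer $d\ge 1$ such that $\exp(\gamma_d(G))=\exp(G)$, and for this $d$ we have $\mathcal B(\gamma_d(G))\subseteq\mathcal W(G)$. (2) Every finite nilpotent group of odd order and of nilpotency class at most $6$ is a $J$-group. -/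

import Mathlib

/-- A group `G` is a *J-group* if there are an element `k` and a function `f : G → G` with
`f (x k) = x f(x)` for all `x`. -/
def IsJGroup (G : Type*) [Group G] : Prop :=
  ∃ (k : G) (f : G → G), ∀ x : G, f (x * k) = x * f x

/-- The ordered product `∏_{i=1}^{n} x k^{n-i} = x k^{n-1} · x k^{n-2} ⋯ x k · x`;
the list index `j` runs through `0, …, n - 1` and stands for `i = j + 1`. -/
def witnessProd {G : Type*} [Group G] (x k : G) (n : ℕ) : G :=
  ((List.range n).map fun j => x * k ^ (n - (j + 1))).prod

/-- `𝒲(G)`: the elements `k` of finite order such that `∏_{i=1}^{|k|} x k^{|k|-i} = 1` for every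
`x` in `G`. -/
def witnesses (G : Type*) [Group G] : Set G :=
  {k | IsOfFinOrder k ∧ ∀ x : G, witnessProd x k (orderOf k) = 1}

/-- `ℬ(G)`: the big elements, whose order is the exponent of `G`. -/
def bigElements (G : Type*) [Group G] : Set G :=
  {x | orderOf x = Monoid.exponent G}

/-- The lower central series `γ_1(G) = G`, `γ_{i+1}(G) = [γ_i(G), G]`, numbered from `1`
(Mathlib numbers it from `0`); only indices `i ≥ 1` are meaningful. -/
def gammaSeries (G : Type*) [Group G] (i : ℕ) : Subgroup G :=
  (⊤ : Subgroup G).lowerCentralSeries (i - 1)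

/-- The positive integers `d` with `exp(γ_d(G)) = exp(G)`. -/
def fullExponentIndices (G : Type*) [Group G] : Set ℕ :=
  {d | 1 ≤ d ∧ Monoid.exponent (gammaSeries G d) = Monoid.exponent G}

/-! A witness `k` makes `G` a `J`-group: on each coset `r⟨k⟩` the recursion `f (x k) = x f(x)`
closes up exactly because the product over one period of `k` is `1`. For odd `n = |k|`, pulling the
powers of `k` to the right turns that product into one of conjugates of `x` by `k ^ T i`, with `T i
= (i + 1).choose 2`, since `n` divides `T n`.

Let `exp G = p ^ (e + 1)` and let `k` be big in `γ_d`, with `d` maximal. Then `H = ⟨x, k⟩` has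
derived subgroup inside `γ_{d+1}(G)`, whose exponent divides `p ^ e`. As `H` has two generators,
`[γ₂, γ₂] ≤ γ₅`; class at most `6` then gives `γ₂(H)` class at most `2`, and by the Baer
correspondence it is a Lie ring killed by `p ^ e`.

In this ring, conjugations by `x` and `k` are unipotent, so their orbits are polynomial. The product
becomes a sum and a double sum over `i < p ^ (e + 1)`, whose coefficients must be divisible by `p ^
e`. By Newton's formula this follows from `(p ^ (e + 1)).choose l` unless `p ^ 2 ∣ l`. The degrees
are below `13`, so the only obstruction is `p = 3`, `l = 9`. It disappears because binomials of
triangular numbers have unexpectedly low degree modulo `3`; `SlowPoly` records both degree bounds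
(`slowPoly_choose_triangle`, `prod_twisted_eq_one`). -/

open scoped commutatorElement

/-! ### Polynomial sequences and finite differences -/

/-- A sequence in an abelian group is polynomial of degree less than `d` if its `d`-th iterated
difference vanishes. -/
def PolyLT {A : Type*} [AddCommGroup A] (d : ℕ) (f : ℕ → A) : Prop :=
  (fwdDiff 1)^[d] f = 0

namespace PolyLT

variable {A : Type*} [AddCommGroup A] {R : Type*} [CommRing R]

theorem succ_iff {d : ℕ} {f : ℕ → A} : PolyLT (d + 1) f ↔ PolyLT d (fwdDiff 1 f) := Iff.rfl

theorem zero (d : ℕ) : PolyLT d (0 : ℕ → A) := by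
  induction d with
  | zero => rfl
  | succ d ih =>
    rw [succ_iff]
    have : fwdDiff 1 (0 : ℕ → A) = 0 := by ext; simp [fwdDiff]
    rwa [this]

theorem mono {d e : ℕ} (h : d ≤ e) {f : ℕ → A} (hf : PolyLT d f) : PolyLT e f := by
  obtain ⟨k, rfl⟩ := Nat.exists_eq_add_of_le h
  rw [PolyLT, add_comm, Function.iterate_add_apply, hf]
  exact zero k

theorem add {d : ℕ} {f g : ℕ → A} (hf : PolyLT d f) (hg : PolyLT d g) : PolyLT d (f + g) := by
  rw [PolyLT, fwdDiff_iter_add, hf, hg, add_zero]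

theorem zsmul {d : ℕ} {f : ℕ → A} (c : ℤ) (hf : PolyLT d f) : PolyLT d (c • f) := by
  rw [PolyLT, fwdDiff_iter_const_smul, hf, smul_zero]

theorem finsetSum {d : ℕ} {ι : Type*} (s : Finset ι) {f : ι → ℕ → A}
    (hf : ∀ i ∈ s, PolyLT d (f i)) : PolyLT d (∑ i ∈ s, f i) := by
  rw [PolyLT, fwdDiff_iter_finsetSum]
  exact Finset.sum_eq_zero hf

theorem shift {d : ℕ} {f : ℕ → A} (hf : PolyLT d f) : PolyLT d (fun n => f (n + 1)) := by
  funext y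
  rw [fwdDiff_iter_comp_add, hf]
  rfl

theorem const (a : A) : PolyLT 1 (fun _ => a) := by
  funext y
  simp [fwdDiff]

theorem newton {d : ℕ} {f : ℕ → A} (hf : PolyLT d f) (n : ℕ) :
    f n = ∑ l ∈ Finset.range d, n.choose l • (fwdDiff 1)^[l] f 0 := by
  have h := shift_eq_sum_fwdDiff_iter 1 f n 0
  simp only [smul_eq_mul, mul_one, zero_add] at h
  rw [h]
  have hz : ∀ l, d ≤ l → (fwdDiff 1)^[l] f = 0 := fun l hl => mono hl hf
  rcases le_total (n + 1) d with hnd | hnd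
  · refine Finset.sum_subset (Finset.range_mono hnd) fun l _ hl => ?_
    rw [Nat.choose_eq_zero_of_lt (by simpa using hl), zero_smul]
  · refine (Finset.sum_subset (Finset.range_mono hnd) fun l _ hl => ?_).symm
    rw [hz l (by simpa using hl), Pi.zero_apply, smul_zero]

theorem fwdDiff_mul (f g : ℕ → R) :
    fwdDiff 1 (f * g) = fwdDiff 1 f * (fun n => g (n + 1)) + f * fwdDiff 1 g := by
  ext n
  simp only [fwdDiff, Pi.mul_apply, Pi.add_apply]
  ring

theorem mul {a b : ℕ} {f g : ℕ → R} (hf : PolyLT (a + 1) f) (hg : PolyLT (b + 1) g) :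
    PolyLT (a + b + 1) (f * g) := by
  induction hs : a + b generalizing a b f g with
  | zero =>
    obtain ⟨rfl, rfl⟩ : a = 0 ∧ b = 0 := by omega
    rw [succ_iff, fwdDiff_mul]
    have h1 : fwdDiff 1 f = 0 := hf
    have h2 : fwdDiff 1 g = 0 := hg
    rw [h1, h2, zero_mul, mul_zero, add_zero]
    exact zero 0
  | succ s ih =>
    rw [succ_iff, fwdDiff_mul]
    refine add ?_ ?_
    · cases a with
      | zero =>
        have h1 : fwdDiff 1 f = 0 := hf
        rw [h1, zero_mul]
        exact zero _
      | succ a => exact ih (a := a) (succ_iff.1 hf) hg.shift (by omega)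
    · cases b with
      | zero =>
        have h1 : fwdDiff 1 g = 0 := hg
        rw [h1, mul_zero]
        exact zero _
      | succ b => exact ih (b := b) hf (succ_iff.1 hg) (by omega)

theorem sum_range {d : ℕ} {f : ℕ → A} (hf : PolyLT d f) :
    PolyLT (d + 1) (fun n => ∑ i ∈ Finset.range n, f i) := by
  rw [succ_iff]
  convert hf using 1
  ext n
  simp [fwdDiff, Finset.sum_range_succ]

theorem choose (l : ℕ) : PolyLT (l + 1) (fun n => (n.choose l : ℤ)) := by
  have h := fwdDiff_iter_choose 0 l
  rw [add_zero] at h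
  rw [PolyLT, Function.iterate_succ_apply', h]
  ext n
  simp [fwdDiff]

theorem map {B : Type*} [AddCommGroup B] (φ : A →+ B) {d : ℕ} {f : ℕ → A} (hf : PolyLT d f) :
    PolyLT d (fun n => φ (f n)) := by
  induction d generalizing f with
  | zero =>
    have : f = 0 := hf
    subst this
    ext
    simp
  | succ d ih =>
    rw [succ_iff]
    convert ih (succ_iff.1 hf) using 1
    ext n
    simp [fwdDiff]

theorem of_mul {d : ℕ} {c : ℤ} (hc : c ≠ 0) {f : ℕ → ℤ} (hf : PolyLT d (c • f)) : PolyLT d f := by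
  rw [PolyLT, fwdDiff_iter_const_smul] at hf
  exact (smul_eq_zero.1 hf).resolve_left hc

theorem map_fwdDiff_iter {B : Type*} [AddCommGroup B] (φ : A →+ B) (d : ℕ) (f : ℕ → A) (n : ℕ) :
    (fwdDiff 1)^[d] (fun n => φ (f n)) n = φ ((fwdDiff 1)^[d] f n) := by
  simp [fwdDiff_iter_eq_sum_shift, map_sum, map_zsmul]

end PolyLT

/-! ### Reduction modulo 3 and divisibility at prime powers -/

/-- Reduction of an integer sequence modulo `3`. -/
def modThree (f : ℕ → ℤ) : ℕ → ZMod 3 := fun n => (f n : ZMod 3)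

theorem PolyLT.modThree {d : ℕ} {f : ℕ → ℤ} (hf : PolyLT d f) : PolyLT d (modThree f) :=
  hf.map (Int.castAddHom (ZMod 3))

theorem three_dvd_fwdDiff_iter {d : ℕ} {f : ℕ → ℤ} (hf : PolyLT d (modThree f)) (n : ℕ) :
    (3 : ℤ) ∣ (fwdDiff 1)^[d] f n := by
  have h := PolyLT.map_fwdDiff_iter (Int.castAddHom (ZMod 3)) d f n
  have h2 : (fwdDiff 1)^[d] (fun n => Int.castAddHom (ZMod 3) (f n)) = 0 := hf
  rw [h2] at h
  exact (ZMod.intCast_zmod_eq_zero_iff_dvd _ 3).1 h.symm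

/-- Absorption: `l * n.choose l = n * (n - 1).choose (l - 1)`. -/
theorem pow_succ_dvd_mul_choose (p e l : ℕ) (hl : 1 ≤ l) :
    p ^ (e + 1) ∣ l * (p ^ (e + 1)).choose l := by
  obtain ⟨l, rfl⟩ := Nat.exists_eq_add_of_le' hl
  rcases Nat.eq_zero_or_pos (p ^ (e + 1)) with h | h
  · rw [h]; simp
  · obtain ⟨n, hn⟩ := Nat.exists_eq_add_of_le' h
    rw [hn, mul_comm, ← Nat.add_one_mul_choose_eq]
    exact dvd_mul_right _ _

/-- The value at `p ^ (e + 1)` of an integer sequence of small degree is divisible by `p ^ e`. -/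
theorem PolyLT.pow_dvd_apply {p : ℕ} (hp : p.Prime) (hp2 : 2 < p) (e : ℕ) {f : ℕ → ℤ}
    (h0 : f 0 = 0) (hf : PolyLT 13 f) (h3 : p = 3 → PolyLT 9 (_root_.modThree f)) :
    ((p ^ e : ℕ) : ℤ) ∣ f (p ^ (e + 1)) := by
  rw [hf.newton]
  refine Finset.dvd_sum fun l hl => ?_
  rw [nsmul_eq_mul]
  have hl13 : l < 13 := Finset.mem_range.1 hl
  rcases Nat.eq_zero_or_pos l with rfl | hlpos
  · simp [h0]
  have hd := pow_succ_dvd_mul_choose p e l hlpos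
  by_cases hpl : p ∣ l
  · obtain ⟨m, rfl⟩ := hpl
    have hd : p ^ e ∣ m * (p ^ (e + 1)).choose (p * m) := by
      rwa [pow_succ' p e, mul_assoc, Nat.mul_dvd_mul_iff_left hp.pos, ← pow_succ'] at hd
    by_cases hpm : p ∣ m
    · obtain ⟨k, rfl⟩ := hpm
      have hk : 0 < k := by
        rcases Nat.eq_zero_or_pos k with rfl | h
        · simp at hlpos
        · exact h
      -- Since `p ^ 2 ∣ l` and `0 < l < 13`, only `p = 3`, `l = 9` survives. The binomial then may
      -- have one factor `3` too few, and the ninth difference, divisible by `3`, supplies it.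
      have hp3 : p = 3 := by
        by_contra hne
        have : 4 ≤ p := by omega
        nlinarith [Nat.mul_le_mul this this, Nat.mul_le_mul (Nat.mul_le_mul this this) hk]
      subst hp3
      have hk1 : k = 1 := by omega
      subst hk1
      obtain ⟨a, ha⟩ := three_dvd_fwdDiff_iter (h3 rfl) 0
      simp only [mul_one] at hd ⊢
      rw [show 3 * 3 = 9 from rfl, ha, ← mul_assoc]
      refine Dvd.dvd.mul_right ?_ _
      rw [mul_comm]
      exact_mod_cast hd
    · have : p ^ e ∣ (p ^ (e + 1)).choose (p * m) :=
        (Nat.Coprime.pow_left e ((Nat.Prime.coprime_iff_not_dvd hp).2 hpm)).dvd_of_dvd_mul_left hd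
      exact Dvd.dvd.mul_right (by exact_mod_cast this) _
  · have : p ^ (e + 1) ∣ (p ^ (e + 1)).choose l :=
      (Nat.Coprime.pow_left _ ((Nat.Prime.coprime_iff_not_dvd hp).2 hpl)).dvd_of_dvd_mul_left hd
    exact Dvd.dvd.mul_right (by exact_mod_cast (pow_dvd_pow p e.le_succ).trans this) _

/-- Integer sequences of degree at most `2 j - 2` whose reduction modulo `3` has degree at most `j`
in case `p = 3`. -/
structure SlowPoly (p j : ℕ) (f : ℕ → ℤ) : Prop where
  polyLT : PolyLT (2 * j - 1) f
  polyLT_modThree : p = 3 → PolyLT (j + 1) (modThree f)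

namespace SlowPoly

variable {p : ℕ}

theorem mono {i j : ℕ} (h : i ≤ j) {f : ℕ → ℤ} (hf : SlowPoly p i f) : SlowPoly p j f :=
  ⟨hf.1.mono (by omega), fun h3 => (hf.2 h3).mono (by omega)⟩

theorem zsmul {j : ℕ} {f : ℕ → ℤ} (c : ℤ) (hf : SlowPoly p j f) : SlowPoly p j (c • f) := by
  refine ⟨hf.1.zsmul c, fun h3 => ?_⟩
  convert (hf.2 h3).zsmul c using 1
  ext n
  simp [modThree]

theorem finsetSum {j : ℕ} {ι : Type*} (s : Finset ι) {f : ι → ℕ → ℤ}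
    (hf : ∀ i ∈ s, SlowPoly p j (f i)) : SlowPoly p j (∑ i ∈ s, f i) := by
  refine ⟨PolyLT.finsetSum s fun i hi => (hf i hi).1, fun h3 => ?_⟩
  convert PolyLT.finsetSum s fun i hi => (hf i hi).2 h3 using 1
  ext n
  simp [modThree]

/-- The level rises by `l` just as `l` applications of a unipotent difference descend `l` steps in
the filtration. -/
theorem choose_mul {j : ℕ} (hj : 1 ≤ j) {f : ℕ → ℤ} (hf : SlowPoly p j f) (l : ℕ) :
    SlowPoly p (j + l) (fun n => (n.choose l : ℤ) * f n) := by
  obtain ⟨j, rfl⟩ := Nat.exists_eq_add_of_le' hj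
  constructor
  · exact ((PolyLT.choose l).mul (b := 2 * j) (hf.1.mono (by omega))).mono (by omega)
  · intro h3
    have := ((PolyLT.choose l).modThree.mul (hf.2 h3)).mono (show _ ≤ j + 1 + l + 1 by omega)
    convert this using 1
    ext n
    simp [modThree]

theorem pow_dvd_sum (hp : p.Prime) (hp2 : 2 < p) (e : ℕ) {j : ℕ} (hj : j ≤ 6)
    {f : ℕ → ℤ} (hf : SlowPoly p j f) :
    ((p ^ e : ℕ) : ℤ) ∣ ∑ i ∈ Finset.range (p ^ (e + 1)), f i := by
  refine PolyLT.pow_dvd_apply (f := fun n => ∑ i ∈ Finset.range n, f i) hp hp2 e (by simp)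
    (hf.1.sum_range.mono (by omega)) fun h3 => ?_
  convert (hf.2 h3).sum_range.mono (show j + 1 + 1 ≤ 9 by omega) using 1
  ext n
  simp [modThree]

/-- Modulo `3` the degree is at most `(i + 1) + j + 1 ≤ 8`: here class `6` is used to the limit. -/
theorem pow_dvd_sum_sum (hp : p.Prime) (hp2 : 2 < p) (e : ℕ) {i j : ℕ} (hi : 1 ≤ i) (hj : 1 ≤ j)
    (hij : i + j ≤ 6) {f g : ℕ → ℤ} (hf : SlowPoly p i f) (hg : SlowPoly p j g) :
    ((p ^ e : ℕ) : ℤ) ∣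
      ∑ s ∈ Finset.range (p ^ (e + 1)), (∑ r ∈ Finset.range s, f r) * g s := by
  obtain ⟨i, rfl⟩ := Nat.exists_eq_add_of_le' hi
  obtain ⟨j, rfl⟩ := Nat.exists_eq_add_of_le' hj
  refine PolyLT.pow_dvd_apply
    (f := fun n => ∑ s ∈ Finset.range n, (∑ r ∈ Finset.range s, f r) * g s) hp hp2 e (by simp)
    ((hf.1.sum_range.mul (b := 2 * j) (hg.1.mono (by omega))).sum_range.mono (by omega))
    fun h3 => ?_
  convert ((hf.2 h3).sum_range.mul (hg.2 h3)).sum_range.mono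
    (show i + 1 + 1 + (j + 1) + 1 + 1 ≤ 9 by omega) using 1
  ext n
  simp [modThree]

end SlowPoly

/-! ### Binomial coefficients of triangular numbers -/

/-- Induction through `(l + 1) * t.choose (l + 1) = (t - l) * t.choose l`; the factor `l + 1`
cancels because `ℤ` is torsion-free. -/
theorem PolyLT.choose_comp {d : ℕ} {t : ℕ → ℕ} (ht : PolyLT (d + 1) (fun n => (t n : ℤ))) (l : ℕ) :
    PolyLT (d * l + 1) (fun n => ((t n).choose l : ℤ)) := by
  induction l with
  | zero => simpa using PolyLT.const (1 : ℤ)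
  | succ l ih =>
    refine PolyLT.of_mul (c := l + 1) (by positivity) ?_
    have h1 : PolyLT (d + 1) (fun n => (t n : ℤ) - l) := by
      have := ht.add ((PolyLT.const (-(l : ℤ))).mono (show 1 ≤ d + 1 by omega))
      simpa only [sub_eq_add_neg] using! this
    have h2 : PolyLT (d * (l + 1) + 1) _ := (ih.mul h1).mono (by rw [mul_add]; omega)
    refine (congrArg (PolyLT _) ?_).mpr h2
    funext n
    simp only [Pi.smul_apply, smul_eq_mul, Pi.mul_apply]
    rcases le_or_gt l (t n) with h | h
    · have := Nat.choose_succ_right_eq (t n) l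
      zify [h] at this
      linarith
    · rw [Nat.choose_eq_zero_of_lt h, Nat.choose_eq_zero_of_lt (by omega)]
      simp

/-- These are the Newton coefficients, in degrees `l + 2` to `2 * l`, of `n ↦ ((n + 1).choose
2).choose l`. The falling factorial form spares the kernel Pascal's recursion. -/
theorem three_dvd_alternating_sum_choose_triangle :
    ∀ l < 6, ∀ m < 2 * l + 1, l + 2 ≤ m → (3 : ℤ) ∣ ∑ k ∈ Finset.range (m + 1),
      ((-1) ^ (m - k) * (m.choose k : ℤ)) *
        (((k * (k + 1) / 2).descFactorial l / l.factorial : ℕ) : ℤ) := by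
  decide +kernel

/-- The integral degree is `2 * l`; modulo `3` the Newton coefficients beyond degree `l + 1` vanish
by finite computation. -/
theorem slowPoly_choose_triangle (p : ℕ) {l : ℕ} (hl : l ≤ 5) :
    SlowPoly p (l + 1) (fun n => (((n + 1).choose 2).choose l : ℤ)) := by
  have h1 := (PolyLT.choose 2).shift.choose_comp l
  refine ⟨h1.mono (by omega), fun _ => ?_⟩
  have h2 := h1.newton
  have key : ∀ m, l + 2 ≤ m → m < 2 * l + 1 →
      (3 : ℤ) ∣ (fwdDiff 1)^[m] (fun n => (((n + 1).choose 2).choose l : ℤ)) 0 := by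
    intro m hm hm'
    rw [fwdDiff_iter_eq_sum_shift]
    convert three_dvd_alternating_sum_choose_triangle l (by omega) m hm' hm using 2 with k
    simp [Nat.choose_eq_descFactorial_div_factorial]
  have h3 : modThree (fun n => (((n + 1).choose 2).choose l : ℤ)) =
      ∑ m ∈ Finset.range (2 * l + 1),
        modThree (fun n => (fwdDiff 1)^[m] (fun n => (((n + 1).choose 2).choose l : ℤ)) 0 *
          (n.choose m : ℤ)) := by
    ext n
    rw [modThree, h2 n]
    simp [modThree, mul_comm]
  rw [h3]
  refine PolyLT.finsetSum _ fun m hm => ?_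
  rcases lt_or_ge m (l + 2) with h | h
  · exact ((PolyLT.choose m).zsmul _).modThree.mono (by omega)
  · have h0 := (ZMod.intCast_zmod_eq_zero_iff_dvd _ 3).2 (key m h (Finset.mem_range.1 hm))
    convert PolyLT.zero (l + 1 + 1) using 1
    ext n
    rw [modThree, Int.cast_mul, h0, zero_mul]
    rfl

theorem PolyLT.comp_triangle (p : ℕ) {d : ℕ} (hd : d ≤ 5) {f : ℕ → ℤ} (hf : PolyLT (d + 1) f) :
    SlowPoly p (d + 1) (fun n => f ((n + 1).choose 2)) := by
  convert SlowPoly.finsetSum (Finset.range (d + 1)) fun l hl =>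
    ((slowPoly_choose_triangle p (l := l) (by have := Finset.mem_range.1 hl; omega)).mono
      (show l + 1 ≤ d + 1 by have := Finset.mem_range.1 hl; omega)).zsmul
      ((fwdDiff 1)^[l] f 0) using 1
  ext n
  rw [hf.newton]
  simp [mul_comm]

/-! ### The Baer correspondence in class two -/

section ClassTwo

variable {N : Type*} [Group N]

theorem commutatorElement_mul_left_of_commute (hc : ∀ a b c : N, Commute ⁅a, b⁆ c) (a b c : N) :
    ⁅a * b, c⁆ = ⁅a, c⁆ * ⁅b, c⁆ := by
  have h : ⁅a * b, c⁆ = a * ⁅b, c⁆ * a⁻¹ * ⁅a, c⁆ := by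
    simp only [commutatorElement_def]; group
  rw [h, ← (hc b c a).eq, mul_inv_cancel_right, (hc b c _).eq]

theorem commutatorElement_mul_right_of_commute (hc : ∀ a b c : N, Commute ⁅a, b⁆ c) (a b c : N) :
    ⁅a, b * c⁆ = ⁅a, b⁆ * ⁅a, c⁆ := by
  have h : ⁅a, b * c⁆ = ⁅a, b⁆ * (b * ⁅a, c⁆ * b⁻¹) := by
    simp only [commutatorElement_def]; group
  rw [h, ← (hc a c b).eq, mul_inv_cancel_right]

end ClassTwo

/-- A group of class at most two whose commutators have square roots, together with the abelian
group structure of the Baer correspondence. -/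
class BaerGroup (N : Type*) [Group N] extends AddCommGroup N where
  /-- The exponent of the square root of commutators. -/
  root : ℕ
  zero_eq_one : (0 : N) = 1
  neg_eq_inv : ∀ a : N, -a = a⁻¹
  zsmul_eq_zpow : ∀ (n : ℤ) (a : N), n • a = a ^ n
  add_eq : ∀ a b : N, a + b = a * b * ⁅b, a⁆ ^ root
  /-- Half of the Lie bracket. -/
  half : N →+ N →+ N
  half_apply : ∀ a b : N, half a b = ⁅a, b⁆ ^ root
  mul_eq : ∀ a b : N, a * b = a + b + half a b
  half_half : ∀ a b c : N, half (half a b) c = 0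

section Construction

variable {N : Type*} [Group N] {s : ℕ}

/-- The Baer correspondence. -/
abbrev BaerGroup.ofClassTwo (hc : ∀ a b c : N, Commute ⁅a, b⁆ c)
    (hs : ∀ a b : N, ⁅a, b⁆ ^ (2 * s) = ⁅a, b⁆) : BaerGroup N := by
  have hz : ∀ a b c : N, Commute (⁅a, b⁆ ^ s) c := fun a b c => (hc a b c).pow_left s
  have hl : ∀ a b c : N, ⁅a * b, c⁆ ^ s = ⁅a, c⁆ ^ s * ⁅b, c⁆ ^ s := fun a b c => by
    rw [commutatorElement_mul_left_of_commute hc, (hc a c _).mul_pow]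
  have hr : ∀ a b c : N, ⁅a, b * c⁆ ^ s = ⁅a, b⁆ ^ s * ⁅a, c⁆ ^ s := fun a b c => by
    rw [commutatorElement_mul_right_of_commute hc, (hc a b _).mul_pow]
  have hinv : ∀ a b : N, ⁅a, b⁆ ^ s * ⁅b, a⁆ ^ s = 1 := fun a b => by
    rw [← commutatorElement_inv a b, inv_pow, mul_inv_cancel]
  have hcl : ∀ a b c : N, ⁅⁅a, b⁆ ^ s, c⁆ ^ s = 1 := fun a b c => by
    rw [commutatorElement_eq_one_iff_commute.2 (hz a b c), one_pow]
  have hcr : ∀ a b c : N, ⁅c, ⁅a, b⁆ ^ s⁆ ^ s = 1 := fun a b c => by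
    rw [commutatorElement_eq_one_iff_commute.2 (hz a b c).symm, one_pow]
  have hsq : ∀ a b : N, ⁅a, b⁆ ^ s * ⁅a, b⁆ ^ s = ⁅a, b⁆ := fun a b => by
    rw [← pow_add, ← two_mul, hs]
  letI i1 : AddCommGroup N :=
    { add := fun a b => a * b * ⁅b, a⁆ ^ s
      zero := 1
      neg := fun a => a⁻¹
      nsmul := fun n a => a ^ n
      zsmul := fun n a => a ^ n
      add_assoc := fun a b c => by
        change (a * b * ⁅b, a⁆ ^ s) * c * ⁅c, a * b * ⁅b, a⁆ ^ s⁆ ^ s =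
          a * (b * c * ⁅c, b⁆ ^ s) * ⁅b * c * ⁅c, b⁆ ^ s, a⁆ ^ s
        rw [hr, hr, hcr, hl, hl, hcl, mul_one, mul_one]
        calc a * b * ⁅b, a⁆ ^ s * c * (⁅c, a⁆ ^ s * ⁅c, b⁆ ^ s)
            = a * b * (⁅b, a⁆ ^ s * c) * (⁅c, a⁆ ^ s * ⁅c, b⁆ ^ s) := by simp only [mul_assoc]
          _ = a * b * (c * ⁅b, a⁆ ^ s) * (⁅c, b⁆ ^ s * ⁅c, a⁆ ^ s) := by
              rw [(hz b a c).eq, (hz c a _).eq]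
          _ = a * b * c * (⁅b, a⁆ ^ s * ⁅c, b⁆ ^ s) * ⁅c, a⁆ ^ s := by simp only [mul_assoc]
          _ = a * b * c * (⁅c, b⁆ ^ s * ⁅b, a⁆ ^ s) * ⁅c, a⁆ ^ s := by rw [(hz b a _).eq]
          _ = _ := by simp only [mul_assoc]
      zero_add := fun a => by
        change 1 * a * ⁅a, 1⁆ ^ s = a
        simp
      add_zero := fun a => by
        change a * 1 * ⁅1, a⁆ ^ s = a
        simp
      nsmul_zero := fun a => pow_zero a
      nsmul_succ := fun n a => by
        change a ^ (n + 1) = a ^ n * a * ⁅a, a ^ n⁆ ^ s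
        rw [commutatorElement_eq_one_iff_commute.2 (Commute.self_pow a n), one_pow, mul_one,
          pow_succ]
      zsmul_zero' := fun a => zpow_zero a
      zsmul_succ' := fun n a => by
        change a ^ ((n.succ : ℕ) : ℤ) = a ^ (n : ℤ) * a * ⁅a, a ^ (n : ℤ)⁆ ^ s
        rw [commutatorElement_eq_one_iff_commute.2 (Commute.self_zpow a n), one_pow, mul_one,
          ← zpow_add_one]
        rfl
      zsmul_neg' := fun n a => by
        change a ^ Int.negSucc n = (a ^ ((n.succ : ℕ) : ℤ))⁻¹
        rw [zpow_negSucc, zpow_natCast]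
      neg_add_cancel := fun a => by
        change a⁻¹ * a * ⁅a, a⁻¹⁆ ^ s = 1
        rw [commutatorElement_eq_one_iff_commute.2 (Commute.refl a).inv_right]
        simp
      add_comm := fun a b => by
        change a * b * ⁅b, a⁆ ^ s = b * a * ⁅a, b⁆ ^ s
        have h : b * a = a * b * ⁅b, a⁆ := by
          rw [← (hc b a _).eq, commutatorElement_def]; group
        rw [h]
        nth_rw 2 [← hsq b a]
        rw [mul_assoc (a * b), mul_assoc (⁅b, a⁆ ^ s), hinv b a, mul_one] }
  have hadd : ∀ a b : N, a + b = a * b * ⁅b, a⁆ ^ s := fun a b => rfl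
  let B : N →+ N →+ N := AddMonoidHom.mk' (fun a => AddMonoidHom.mk' (fun b => ⁅a, b⁆ ^ s)
    (fun b c => by
      rw [hadd, hadd, hr, hr, hcr, hcl]))
    (fun a b => by
      ext c
      change ⁅a + b, c⁆ ^ s = ⁅a, c⁆ ^ s + ⁅b, c⁆ ^ s
      rw [hadd, hadd, hl, hl, hcr, hcl])
  exact
    { i1 with
      root := s
      zero_eq_one := rfl
      neg_eq_inv := fun _ => rfl
      zsmul_eq_zpow := fun _ _ => rfl
      add_eq := hadd
      half := B
      half_apply := fun _ _ => rfl
      mul_eq := fun a b => by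
        change a * b = a + b + ⁅a, b⁆ ^ s
        rw [hadd, hadd, hcl, mul_one, mul_assoc, hinv, mul_one]
      half_half := fun a b c => hcl a b c }

end Construction

namespace BaerGroup

variable {N : Type*} [Group N] [BaerGroup N]

theorem half_sum_half {ι : Type*} (s : Finset ι) (f g : ι → N) (c : N) :
    half (N := N) (∑ j ∈ s, half (N := N) (f j) (g j)) c = 0 := by
  rw [map_sum, AddMonoidHom.finsetSum_apply]
  exact Finset.sum_eq_zero fun j _ => half_half _ _ _

/-- The Baker–Campbell–Hausdorff formula stops after one bracket: brackets are central, so only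
partial sums paired with the next term contribute. -/
theorem prod_range_map (v : ℕ → N) (n : ℕ) :
    ((List.range n).map v).prod = ∑ i ∈ Finset.range n, v i +
      ∑ j ∈ Finset.range n, half (N := N) (∑ i ∈ Finset.range j, v i) (v j) := by
  induction n with
  | zero => simp [zero_eq_one]
  | succ n ih =>
    rw [List.range_succ, List.map_append, List.prod_append, ih, List.map_singleton,
      List.prod_singleton, mul_eq, map_add, AddMonoidHom.add_apply, half_sum_half, add_zero,
      Finset.sum_range_succ, Finset.sum_range_succ]
    abel

/-- A group automorphism is an automorphism of the Baer sum. -/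
def addHom (φ : N →* N) : AddMonoid.End N :=
  AddMonoidHom.mk' φ fun a b => by
    simp only [add_eq, map_mul, map_pow, map_commutatorElement]

@[simp] theorem addHom_apply (φ : N →* N) (a : N) : addHom φ a = φ a := rfl

end BaerGroup

/-! ### Lower central series of two-generated groups -/

section Commutators

variable {H : Type*} [Group H]

open Subgroup

theorem Subgroup.commutator_commutator_le_of_rotate {H₁ H₂ H₃ K : Subgroup H} [K.Normal]
    (h1 : ⁅⁅H₂, H₃⁆, H₁⁆ ≤ K) (h2 : ⁅⁅H₃, H₁⁆, H₂⁆ ≤ K) : ⁅⁅H₁, H₂⁆, H₃⁆ ≤ K := by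
  have key : ∀ L : Subgroup H, L ≤ K ↔ L.map (QuotientGroup.mk' K) = ⊥ := fun L => by
    rw [Subgroup.map_eq_bot_iff, QuotientGroup.ker_mk']
  rw [key] at h1 h2 ⊢
  simp only [Subgroup.map_commutator] at h1 h2 ⊢
  exact Subgroup.commutator_commutator_eq_bot_of_rotate h1 h2

theorem Subgroup.commutator_lowerCentralSeries_le (i j : ℕ) :
    ⁅(⊤ : Subgroup H).lowerCentralSeries i, (⊤ : Subgroup H).lowerCentralSeries j⁆ ≤
      (⊤ : Subgroup H).lowerCentralSeries (i + j + 1) := by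
  induction i generalizing j with
  | zero =>
    rw [Subgroup.commutator_comm, zero_add]
    exact le_rfl
  | succ i ih =>
    rw [Subgroup.lowerCentralSeries_succ]
    refine Subgroup.commutator_commutator_le_of_rotate ?_ ?_
    · rw [Subgroup.commutator_comm ⊤, Subgroup.commutator_comm,
        ← Subgroup.lowerCentralSeries_succ]
      exact (ih (j + 1)).trans_eq (by congr 1; omega)
    · rw [Subgroup.commutator_comm (Subgroup.lowerCentralSeries ⊤ j)]
      exact (Subgroup.commutator_mono (ih j) le_rfl).trans_eq
        (by rw [← Subgroup.lowerCentralSeries_succ]; congr 1; omega)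

theorem Subgroup.commutatorElement_mem_lowerCentralSeries {i j : ℕ} {a b : H}
    (ha : a ∈ (⊤ : Subgroup H).lowerCentralSeries i)
    (hb : b ∈ (⊤ : Subgroup H).lowerCentralSeries j) :
    ⁅a, b⁆ ∈ (⊤ : Subgroup H).lowerCentralSeries (i + j + 1) :=
  Subgroup.commutator_lowerCentralSeries_le i j (Subgroup.commutator_mem_commutator ha hb)

/-- In a group generated by two elements, the derived subgroup is the normal closure of their
commutator. -/
theorem commutator_le_of_closure_pair {x k : H} (hgen : closure {x, k} = ⊤) {L : Subgroup H}
    [L.Normal] (h : ⁅x, k⁆ ∈ L) : commutator H ≤ L := by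
  have hq : closure {(x : H ⧸ L), (k : H ⧸ L)} = ⊤ := by
    have := congrArg (Subgroup.map (QuotientGroup.mk' L)) hgen
    rw [MonoidHom.map_closure, Set.image_pair,
      Subgroup.map_top_of_surjective _ (QuotientGroup.mk'_surjective L)] at this
    exact this
  have hxk : Commute (x : H ⧸ L) (k : H ⧸ L) := by
    rw [← commutatorElement_eq_one_iff_commute]
    exact (QuotientGroup.eq_one_iff _).2 h
  have hcen : ∀ y : H ⧸ L, Commute (x : H ⧸ L) y → Commute (k : H ⧸ L) y → y ∈ center (H ⧸ L) := by
    intro y h1 h2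
    have : closure {(x : H ⧸ L), (k : H ⧸ L)} ≤ centralizer {y} := by
      rw [closure_le]
      rintro z (rfl | rfl)
      · exact mem_centralizer_singleton_iff.2 h1
      · exact mem_centralizer_singleton_iff.2 h2
    rw [hq] at this
    exact mem_center_iff.2 fun g => mem_centralizer_singleton_iff.1 (this (mem_top g))
  have htop : center (H ⧸ L) = ⊤ := by
    rw [eq_top_iff, ← hq, closure_le]
    rintro z (rfl | rfl)
    · exact hcen _ (Commute.refl _) hxk.symm
    · exact hcen _ hxk (Commute.refl _)
  rw [commutator_def, commutator_le]
  intro a _ b _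
  rw [← QuotientGroup.eq_one_iff]
  change ⁅(a : H ⧸ L), (b : H ⧸ L)⁆ = 1
  rw [commutatorElement_eq_one_iff_commute]
  have ha : (a : H ⧸ L) ∈ center (H ⧸ L) := by rw [htop]; exact mem_top _
  exact (mem_center_iff.1 ha b).symm

/-- `γ₂/γ₃` is cyclic, generated by `⁅x, k⁆`. The subgroup `E ⊓ γ₂` is normal because its
commutators with the group lie in `γ₃`, hence in it. -/
theorem lowerCentralSeries_one_le_of_closure_pair {x k : H} (hgen : closure {x, k} = ⊤)
    {E : Subgroup H} (h : ⁅x, k⁆ ∈ E) (h2 : (⊤ : Subgroup H).lowerCentralSeries 2 ≤ E) :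
    (⊤ : Subgroup H).lowerCentralSeries 1 ≤ E := by
  have hn : (E ⊓ (⊤ : Subgroup H).lowerCentralSeries 1).Normal := by
    rw [← commutator_top_right_le_iff]
    refine le_inf ?_ ?_
    · exact (commutator_mono inf_le_right le_rfl).trans h2
    · exact (commutator_mono inf_le_right le_rfl).trans
        (Subgroup.lowerCentralSeries_antitone (⊤ : Subgroup H) (show 1 ≤ 2 by norm_num))
  exact (commutator_le_of_closure_pair hgen (L := E ⊓ (⊤ : Subgroup H).lowerCentralSeries 1)
    ⟨h, commutator_mem_commutator (mem_top x) (mem_top k)⟩).trans inf_le_left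

/-- Modulo `L`, `γ₃` centralizes `γ₂`, so each argument can be replaced by the generator `⁅x, k⁆` of
`γ₂/γ₃`, which commutes with itself. -/
theorem commutatorElement_mem_of_closure_pair {x k : H} (hgen : closure {x, k} = ⊤)
    {L : Subgroup H} [L.Normal]
    (hL : ⁅(⊤ : Subgroup H).lowerCentralSeries 2, (⊤ : Subgroup H).lowerCentralSeries 1⁆ ≤ L)
    {a b : H} (ha : a ∈ (⊤ : Subgroup H).lowerCentralSeries 1)
    (hb : b ∈ (⊤ : Subgroup H).lowerCentralSeries 1) : ⁅a, b⁆ ∈ L := by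
  have hmem : ∀ g h : H, (g : H ⧸ L) ∈ centralizer {(h : H ⧸ L)} ↔ ⁅g, h⁆ ∈ L := fun g h => by
    rw [mem_centralizer_singleton_iff, ← QuotientGroup.eq_one_iff]
    exact commutatorElement_eq_one_iff_mul_comm.symm
  have hu : ⁅x, k⁆ ∈ (⊤ : Subgroup H).lowerCentralSeries 1 :=
    commutator_mem_commutator (mem_top x) (mem_top k)
  have step : ∀ h ∈ (⊤ : Subgroup H).lowerCentralSeries 1, ⁅⁅x, k⁆, h⁆ ∈ L →
      ∀ g ∈ (⊤ : Subgroup H).lowerCentralSeries 1, ⁅g, h⁆ ∈ L := by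
    intro h hh hxk g hg
    refine (hmem g h).1 (lowerCentralSeries_one_le_of_closure_pair hgen
      (E := (centralizer {(h : H ⧸ L)}).comap (QuotientGroup.mk' L)) ?_ ?_ hg)
    · exact (hmem _ h).2 hxk
    · exact fun y hy => (hmem y h).2 (hL (commutator_mem_commutator hy hh))
  refine step b hb ?_ a ha
  rw [← commutatorElement_inv]
  exact inv_mem (step _ hu (by rw [commutatorElement_self]; exact one_mem _) b hb)

/-- In a group generated by two elements, `[γ₂, γ₂] ≤ γ₅` (indexed here from zero). -/
theorem commutatorElement_mem_lowerCentralSeries_four {x k : H} (hgen : closure {x, k} = ⊤)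
    {a b : H} (ha : a ∈ (⊤ : Subgroup H).lowerCentralSeries 1)
    (hb : b ∈ (⊤ : Subgroup H).lowerCentralSeries 1) :
    ⁅a, b⁆ ∈ (⊤ : Subgroup H).lowerCentralSeries 4 :=
  commutatorElement_mem_of_closure_pair hgen (commutator_lowerCentralSeries_le 2 1) ha hb

end Commutators

open BaerGroup

/-! ### Unipotent orbits and slow sequences in a Lie ring -/

section Unipotent

variable {A : Type*} [AddCommGroup A]

/-- The difference between an endomorphism and the identity. -/
def endSubOne (X : A →+ A) : A →+ A := X - AddMonoidHom.id A

theorem fwdDiff_iter_orbit (X : A →+ A) (l : ℕ) (c : A) :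
    (fwdDiff 1)^[l] (fun i : ℕ => X^[i] c) = fun i => X^[i] ((endSubOne X)^[l] c) := by
  induction l generalizing c with
  | zero => rfl
  | succ l ih =>
    rw [Function.iterate_succ_apply, Function.iterate_succ_apply, ← ih]
    congr 1
    ext i
    have : X^[i + 1] c - X^[i] c = X^[i] (X c - c) := by
      rw [Function.iterate_succ_apply, iterate_map_sub]
    exact this

theorem iterate_eq_sum_choose (X : A →+ A) {d : ℕ} {c : A} (hd : (endSubOne X)^[d] c = 0)
    (i : ℕ) : X^[i] c = ∑ l ∈ Finset.range d, i.choose l • (endSubOne X)^[l] c := by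
  have h : PolyLT d (fun i : ℕ => X^[i] c) := by
    rw [PolyLT, fwdDiff_iter_orbit, hd]
    ext i
    exact iterate_map_zero X i
  rw [h.newton i]
  simp only [fwdDiff_iter_orbit, Function.iterate_zero, id]

end Unipotent

/-- A central filtration of class at most six on the Lie ring of a Baer group. -/
structure IsLieFiltration {L : Type*} [Group L] [BaerGroup L] (Fil : ℕ → AddSubgroup L) :
    Prop where
  antitone : Antitone Fil
  half_mem : ∀ {i j : ℕ}, 1 ≤ i → 1 ≤ j → ∀ {a b : L}, a ∈ Fil i → b ∈ Fil j →
    half (N := L) a b ∈ Fil (i + j)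
  eq_zero : ∀ a ∈ Fil 7, a = 0

/-- `X` acts trivially on the quotients of the filtration. -/
def IsUnipotent {A : Type*} [AddCommGroup A] (Fil : ℕ → AddSubgroup A) (X : A →+ A) : Prop :=
  ∀ j, 1 ≤ j → ∀ c ∈ Fil j, endSubOne X c ∈ Fil (j + 1)

theorem IsUnipotent.iterate_mem {A : Type*} [AddCommGroup A] {Fil : ℕ → AddSubgroup A}
    {X : A →+ A} (hX : IsUnipotent Fil X) {j : ℕ} (hj : 1 ≤ j) {c : A} (hc : c ∈ Fil j) (l : ℕ) :
    (endSubOne X)^[l] c ∈ Fil (j + l) := by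
  induction l with
  | zero => exact hc
  | succ l ih =>
    rw [Function.iterate_succ_apply']
    exact hX (j + l) (by omega) _ ih

section SlowSeq

variable {L : Type*} [Group L] [BaerGroup L]

/-- The sequences spanned by the `i ↦ f i • c` with `c` in the `j`-th term of the filtration and
`f` a slow polynomial of level `j`. -/
def slowSeq (p : ℕ) (Fil : ℕ → AddSubgroup L) : AddSubgroup (ℕ → L) :=
  AddSubgroup.closure {v | ∃ j, 1 ≤ j ∧ ∃ c ∈ Fil j, ∃ f, SlowPoly p j f ∧ v = fun i => f i • c}

variable {p : ℕ} {Fil : ℕ → AddSubgroup L}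

theorem smul_mem_slowSeq {j : ℕ} (hj : 1 ≤ j) {c : L} (hc : c ∈ Fil j) {f : ℕ → ℤ}
    (hf : SlowPoly p j f) : (fun i => f i • c) ∈ slowSeq p Fil :=
  AddSubgroup.subset_closure ⟨j, hj, c, hc, f, hf, rfl⟩

/-- Expanding `X ^ i = (1 + (X - 1)) ^ i`, the coefficient `i.choose l` comes with a vector `l`
steps deeper, so the levels still match. -/
theorem iterate_mem_slowSeq (hFil : IsLieFiltration Fil) {X : L →+ L} (hX : IsUnipotent Fil X)
    {v : ℕ → L} (hv : v ∈ slowSeq p Fil) : (fun i => X^[i] (v i)) ∈ slowSeq p Fil := by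
  induction hv using AddSubgroup.closure_induction with
  | mem v hv =>
    obtain ⟨j, hj, c, hc, f, hf, rfl⟩ := hv
    have h7 : (endSubOne X)^[7] c = 0 :=
      hFil.eq_zero _ (hFil.antitone (show 7 ≤ j + 7 by omega) (hX.iterate_mem hj hc 7))
    have : (fun i => X^[i] (f i • c)) = ∑ l ∈ Finset.range 7,
        fun i => ((i.choose l : ℤ) * f i) • (endSubOne X)^[l] c := by
      ext i
      rw [iterate_map_zsmul, iterate_eq_sum_choose X h7, Finset.smul_sum, Finset.sum_apply]
      refine Finset.sum_congr rfl fun l _ => ?_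
      rw [mul_comm, mul_smul, natCast_zsmul]
    rw [this]
    exact sum_mem fun l _ =>
      smul_mem_slowSeq (by omega) (hX.iterate_mem hj hc l) (hf.choose_mul hj l)
  | zero => simpa only [Pi.zero_apply, iterate_map_zero] using! zero_mem (slowSeq p Fil)
  | add v w _ _ hv hw => simpa only [Pi.add_apply, iterate_map_add] using! add_mem hv hw
  | neg v _ hv => simpa only [Pi.neg_apply, iterate_map_neg] using! neg_mem hv

theorem zsmul_eq_zero_of_dvd {q : ℕ} (hq : ∀ a : L, q • a = 0) {z : ℤ} (hz : (q : ℤ) ∣ z) (a : L) :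
    z • a = 0 := by
  obtain ⟨m, rfl⟩ := hz
  rw [mul_comm, mul_smul, natCast_zsmul, hq, smul_zero]

theorem sum_eq_zero_of_mem_slowSeq (hp : p.Prime) (hp2 : 2 < p) {e : ℕ}
    (hFil : IsLieFiltration Fil) (hq : ∀ a : L, p ^ e • a = 0)
    {v : ℕ → L} (hv : v ∈ slowSeq p Fil) : ∑ i ∈ Finset.range (p ^ (e + 1)), v i = 0 := by
  induction hv using AddSubgroup.closure_induction with
  | mem v hv =>
    obtain ⟨j, hj, c, hc, f, hf, rfl⟩ := hv
    rw [← Finset.sum_smul]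
    rcases le_or_gt j 6 with h | h
    · exact zsmul_eq_zero_of_dvd hq (hf.pow_dvd_sum hp hp2 e h) c
    · rw [hFil.eq_zero c (hFil.antitone h hc), smul_zero]
  | zero => simp
  | add v w _ _ hv hw => simp only [Pi.add_apply, Finset.sum_add_distrib, hv, hw, add_zero]
  | neg v _ hv => simp only [Pi.neg_apply, Finset.sum_neg_distrib, hv, neg_zero]

theorem sum_half_eq_zero_of_mem_slowSeq (hp : p.Prime) (hp2 : 2 < p) {e : ℕ}
    (hFil : IsLieFiltration Fil) (hq : ∀ a : L, p ^ e • a = 0)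
    {v w : ℕ → L} (hv : v ∈ slowSeq p Fil) (hw : w ∈ slowSeq p Fil) :
    ∑ s ∈ Finset.range (p ^ (e + 1)), half (N := L) (∑ r ∈ Finset.range s, v r) (w s) = 0 := by
  induction hv using AddSubgroup.closure_induction with
  | mem v hv =>
    obtain ⟨i, hi, c, hc, f, hf, rfl⟩ := hv
    induction hw using AddSubgroup.closure_induction with
    | mem w hw =>
      obtain ⟨j, hj, d, hd, g, hg, rfl⟩ := hw
      have : ∀ s, half (N := L) (∑ r ∈ Finset.range s, f r • c) (g s • d) =
          ((∑ r ∈ Finset.range s, f r) * g s) • half (N := L) c d := fun s => by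
        rw [← Finset.sum_smul, map_zsmul, map_zsmul, AddMonoidHom.zsmul_apply, mul_comm, mul_smul]
      simp only [this]
      rw [← Finset.sum_smul]
      have hm := hFil.half_mem hi hj hc hd
      rcases le_or_gt (i + j) 6 with h | h
      · exact zsmul_eq_zero_of_dvd hq (hf.pow_dvd_sum_sum hp hp2 e hi hj h hg) _
      · rw [hFil.eq_zero _ (hFil.antitone h hm), smul_zero]
    | zero => simp
    | add w w' _ _ hw hw' => simp only [Pi.add_apply, map_add, Finset.sum_add_distrib, hw, hw',
        add_zero]
    | neg w _ hw => simp only [Pi.neg_apply, map_neg, Finset.sum_neg_distrib, hw, neg_zero]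
  | zero => simp
  | add v v' _ _ hv hv' => simp only [Pi.add_apply, Finset.sum_add_distrib, map_add,
      AddMonoidHom.add_apply, hv, hv', add_zero]
  | neg v _ hv => simp only [Pi.neg_apply, Finset.sum_neg_distrib, map_neg,
      AddMonoidHom.neg_apply, hv, neg_zero]

theorem comp_triangle_smul_mem_slowSeq {d : ℕ} (hd : d ≤ 5) {f : ℕ → ℤ} (hf : PolyLT (d + 1) f)
    {c : L} (hc : c ∈ Fil (d + 1)) :
    (fun i : ℕ => f ((i + 1).choose 2) • c) ∈ slowSeq p Fil :=
  smul_mem_slowSeq (by omega) hc (hf.comp_triangle p hd)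

theorem prod_iterate_mem_slowSeq (hFil : IsLieFiltration Fil) {X : L →+ L}
    (hX : IsUnipotent Fil X) {c : L} (hc : c ∈ Fil 2) :
    (fun i : ℕ => ((List.range ((i + 1).choose 2)).map fun r => X^[r] c).prod) ∈ slowSeq p Fil := by
  have h5 : (endSubOne X)^[5] c = 0 := hFil.eq_zero _ (hX.iterate_mem (by omega) hc 5)
  have horb := fun i => iterate_eq_sum_choose X h5 i
  simp only [prod_range_map]
  have hsum : ∀ t, ∑ r ∈ Finset.range t, X^[r] c = ∑ l ∈ Finset.range 5,
      (∑ r ∈ Finset.range t, (r.choose l : ℤ)) • (endSubOne X)^[l] c := fun t => by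
    simp only [horb, Finset.sum_smul, natCast_zsmul]
    exact Finset.sum_comm
  have hquad : ∀ t, ∑ s ∈ Finset.range t, half (N := L) (∑ r ∈ Finset.range s, X^[r] c) (X^[s] c) =
      ∑ l ∈ Finset.range 5, ∑ m ∈ Finset.range 5,
        (∑ s ∈ Finset.range t, (∑ r ∈ Finset.range s, (r.choose l : ℤ)) * (s.choose m : ℤ)) •
          half (N := L) ((endSubOne X)^[l] c) ((endSubOne X)^[m] c) := fun t => by
    have : ∀ s, half (N := L) (∑ r ∈ Finset.range s, X^[r] c) (X^[s] c) =
        ∑ l ∈ Finset.range 5, ∑ m ∈ Finset.range 5,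
        ((∑ r ∈ Finset.range s, (r.choose l : ℤ)) * (s.choose m : ℤ)) •
          half (N := L) ((endSubOne X)^[l] c) ((endSubOne X)^[m] c) := fun s => by
      rw [hsum, map_sum (half (N := L)), AddMonoidHom.finsetSum_apply]
      refine Finset.sum_congr rfl fun l _ => ?_
      rw [horb, map_sum]
      refine Finset.sum_congr rfl fun m _ => ?_
      rw [← natCast_zsmul, map_zsmul, map_zsmul, AddMonoidHom.zsmul_apply, mul_comm, mul_smul]
    simp only [this, Finset.sum_smul]
    rw [Finset.sum_comm]
    exact Finset.sum_congr rfl fun l _ => Finset.sum_comm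
  simp only [hquad]
  simp only [hsum]
  refine add_mem ?_ ?_
  · have := AddSubgroup.sum_mem (slowSeq p Fil) fun l (hl : l ∈ Finset.range 5) =>
      comp_triangle_smul_mem_slowSeq (p := p) (Fil := Fil) (d := l + 1)
        (by have := Finset.mem_range.1 hl; omega) (PolyLT.choose l).sum_range
        (c := (endSubOne X)^[l] c) (by
          have := hX.iterate_mem (by omega) hc l
          rwa [add_comm 2 l] at this)
    simpa only [Finset.sum_fn] using! this
  · have hterm : ∀ l m, (fun i : ℕ => (∑ s ∈ Finset.range ((i + 1).choose 2),
        (∑ r ∈ Finset.range s, (r.choose l : ℤ)) * (s.choose m : ℤ)) •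
          half (N := L) ((endSubOne X)^[l] c) ((endSubOne X)^[m] c)) ∈ slowSeq p Fil := by
      intro l m
      have hm := hFil.half_mem (by omega) (by omega) (hX.iterate_mem (by omega) hc l)
        (hX.iterate_mem (by omega) hc m)
      -- The bracket lies in `Fil (l + m + 4)`, which is zero once `l + m > 2`; otherwise the
      -- coefficient has degree at most `l + m + 2` in the triangular number.
      rcases le_or_gt (l + m) 2 with h | h
      · exact comp_triangle_smul_mem_slowSeq (d := l + m + 2) (by omega)
          (f := fun t => ∑ s ∈ Finset.range t,
            (∑ r ∈ Finset.range s, (r.choose l : ℤ)) * (s.choose m : ℤ))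
          (((PolyLT.choose l).sum_range.mul (PolyLT.choose m)).sum_range.mono (by omega))
          (hFil.antitone (by omega) hm)
      · rw [hFil.eq_zero _ (hFil.antitone (by omega) hm)]
        simpa only [smul_zero] using! zero_mem (slowSeq p Fil)
    have := AddSubgroup.sum_mem (slowSeq p Fil) fun l (_ : l ∈ Finset.range 5) =>
      AddSubgroup.sum_mem (slowSeq p Fil) fun m (_ : m ∈ Finset.range 5) => hterm l m
    simpa only [Finset.sum_fn] using! this

/-- The ordered product of a twisted orbit product along triangular numbers vanishes. -/
theorem prod_twisted_eq_one (hp : p.Prime) (hp2 : 2 < p) {e : ℕ}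
    (hFil : IsLieFiltration Fil) (hq : ∀ a : L, p ^ e • a = 0) {X K : L →+ L}
    (hX : IsUnipotent Fil X) (hK : IsUnipotent Fil K) {c : L} (hc : c ∈ Fil 2) :
    ((List.range (p ^ (e + 1))).map fun i =>
      X^[i] ((List.range ((i + 1).choose 2)).map fun r => K^[r] c).prod).prod = 1 := by
  have h := iterate_mem_slowSeq hFil hX (prod_iterate_mem_slowSeq (p := p) hFil hK hc)
  rw [prod_range_map, sum_eq_zero_of_mem_slowSeq hp hp2 hFil hq h,
    sum_half_eq_zero_of_mem_slowSeq hp hp2 hFil hq h h, add_zero, zero_eq_one]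

end SlowSeq

/-! ### The derived subgroup as a filtered Lie ring -/

/-- A subgroup is closed under the Baer sum. -/
def BaerGroup.addSubgroup {N : Type*} [Group N] [BaerGroup N] (S : Subgroup N) :
    AddSubgroup N where
  carrier := S
  zero_mem' := by
    rw [zero_eq_one]
    exact S.one_mem
  add_mem' {a b} ha hb := by
    rw [add_eq, commutatorElement_def]
    exact S.mul_mem (S.mul_mem ha hb) (S.pow_mem (S.mul_mem (S.mul_mem (S.mul_mem hb ha)
      (S.inv_mem hb)) (S.inv_mem ha)) _)
  neg_mem' {a} ha := by
    rw [neg_eq_inv]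
    exact S.inv_mem ha

section DerivedSubgroup

variable {H : Type*} [Group H]

/-- The filtration of the derived subgroup by the lower central series, numbered from one. -/
def derivedFiltration [BaerGroup ((⊤ : Subgroup H).lowerCentralSeries 1)] (j : ℕ) :
    AddSubgroup ((⊤ : Subgroup H).lowerCentralSeries 1) :=
  BaerGroup.addSubgroup (((⊤ : Subgroup H).lowerCentralSeries (j - 1)).subgroupOf _)

variable [BaerGroup ((⊤ : Subgroup H).lowerCentralSeries 1)]

theorem mem_derivedFiltration {j : ℕ} {a : (⊤ : Subgroup H).lowerCentralSeries 1} :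
    a ∈ derivedFiltration j ↔ (a : H) ∈ (⊤ : Subgroup H).lowerCentralSeries (j - 1) := Iff.rfl

theorem isLieFiltration_derivedFiltration (hcl : (⊤ : Subgroup H).lowerCentralSeries 6 = ⊥) :
    IsLieFiltration (derivedFiltration (H := H)) where
  antitone i j hij a ha :=
    Subgroup.lowerCentralSeries_antitone (⊤ : Subgroup H) (Nat.sub_le_sub_right hij 1) ha
  half_mem {i j} hi hj {a b} ha hb := by
    rw [half_apply, mem_derivedFiltration, Subgroup.coe_pow]
    refine Subgroup.pow_mem _ ?_ _
    have := Subgroup.commutatorElement_mem_lowerCentralSeries ha hb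
    rwa [show i - 1 + (j - 1) + 1 = i + j - 1 by omega] at this
  eq_zero a ha := by
    rw [mem_derivedFiltration, show 7 - 1 = 6 from rfl, hcl, Subgroup.mem_bot] at ha
    rw [zero_eq_one]
    exact Subtype.ext ha

/-- Conjugation by an element as an automorphism of the Lie ring of the derived subgroup. -/
def derivedConj (g : H) : (⊤ : Subgroup H).lowerCentralSeries 1 →+
    (⊤ : Subgroup H).lowerCentralSeries 1 :=
  BaerGroup.addHom (MulAut.conjNormal g).toMonoidHom

theorem coe_derivedConj (g : H) (a : (⊤ : Subgroup H).lowerCentralSeries 1) :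
    (derivedConj g a : H) = g * a * g⁻¹ :=
  MulAut.conjNormal_apply g a

theorem coe_derivedConj_iterate (g : H) (i : ℕ) (a : (⊤ : Subgroup H).lowerCentralSeries 1) :
    (((derivedConj g)^[i] a : (⊤ : Subgroup H).lowerCentralSeries 1) : H) =
      g ^ i * a * (g ^ i)⁻¹ := by
  induction i with
  | zero =>
    simp
    rfl
  | succ i ih =>
    rw [Function.iterate_succ_apply', coe_derivedConj, ih, pow_succ']
    group

theorem isUnipotent_derivedConj (g : H) : IsUnipotent derivedFiltration (derivedConj g) := by
  intro j hj c hc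
  have hc' : (c : H) ∈ (⊤ : Subgroup H).lowerCentralSeries (j - 1) := hc
  have hX : g * c * g⁻¹ ∈ (⊤ : Subgroup H).lowerCentralSeries (j - 1) :=
    Subgroup.Normal.conj_mem inferInstance _ hc' g
  change derivedConj g c - c ∈ _
  -- The Baer difference is `⁅g, c⁆` times a power of a commutator of two elements of `γ_j`; both
  -- factors lie in `γ_{j+1}`.
  rw [sub_eq_add_neg, neg_eq_inv, add_eq, mem_derivedFiltration, add_tsub_cancel_right]
  rw [Subgroup.coe_mul, Subgroup.coe_pow, Subgroup.coe_mul]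
  refine Subgroup.mul_mem _ ?_ (Subgroup.pow_mem _ ?_ _)
  · rw [coe_derivedConj]
    have := Subgroup.commutatorElement_mem_lowerCentralSeries (i := 0) (Subgroup.mem_top g) hc'
    rwa [show 0 + (j - 1) + 1 = j by omega] at this
  · have := Subgroup.commutatorElement_mem_lowerCentralSeries
      (Subgroup.inv_mem _ hc') (coe_derivedConj g c ▸ hX)
    exact Subgroup.lowerCentralSeries_antitone _ (by omega) this

end DerivedSubgroup

/-! ### The product of conjugates along triangular numbers -/

section Key

variable {H : Type*} [Group H]

/-- A telescoping product: `⁅x⁻¹, (k ^ t)⁻¹⁆` is an orbit product of `⁅x⁻¹, k⁻¹⁆` under conjugation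
by `k⁻¹`. -/
theorem prod_conj_pow_eq (x k : H) (t : ℕ) :
    ((List.range t).map fun r => k⁻¹ ^ r * ⁅x⁻¹, k⁻¹⁆ * (k⁻¹ ^ r)⁻¹).prod =
      x⁻¹ * (k ^ t)⁻¹ * x * k ^ t := by
  induction t with
  | zero => simp
  | succ t ih =>
    rw [List.range_succ, List.map_append, List.prod_append, ih, List.map_singleton,
      List.prod_singleton, commutatorElement_def, pow_succ', inv_pow]
    group

/-- Collecting every `x` on the right twists the `i`-th factor by `x ^ i`, up to one overall
conjugation. -/
theorem prod_conj_eq_conj_prod (x : H) (u : ℕ → H) (m : ℕ) :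
    ((List.range m).map fun i => x * u i).prod =
      x * ((List.range m).map fun i => x ^ i * u i * (x ^ i)⁻¹).prod * x⁻¹ * x ^ m := by
  induction m with
  | zero => simp
  | succ m ih =>
    rw [List.range_succ, List.map_append, List.prod_append, ih, List.map_singleton,
      List.prod_singleton, List.map_append, List.prod_append, List.map_singleton,
      List.prod_singleton, pow_succ']
    group

theorem prod_conj_triangle_eq_one_of_closure_pair {x k : H}
    (hgen : Subgroup.closure {x, k} = ⊤) (hcl : (⊤ : Subgroup H).lowerCentralSeries 6 = ⊥)
    {p : ℕ} (hp : p.Prime) (hp2 : 2 < p) {e : ℕ} (hx : x ^ p ^ (e + 1) = 1)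
    (hN : ∀ g ∈ (⊤ : Subgroup H).lowerCentralSeries 1, g ^ p ^ e = 1) :
    ((List.range (p ^ (e + 1))).map fun i =>
      (k ^ (i + 1).choose 2)⁻¹ * x * k ^ (i + 1).choose 2).prod = 1 := by
  have hc : ∀ a b c : (⊤ : Subgroup H).lowerCentralSeries 1, Commute ⁅a, b⁆ c := by
    intro a b c
    have := Subgroup.commutatorElement_mem_lowerCentralSeries
      (commutatorElement_mem_lowerCentralSeries_four hgen a.2 b.2) c.2
    rw [show 4 + 1 + 1 = 6 from rfl, hcl, Subgroup.mem_bot] at this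
    rw [← commutatorElement_eq_one_iff_commute]
    exact Subtype.ext this
  -- The exponent `s` is one half modulo the odd number `p ^ e`, which kills the derived subgroup.
  obtain ⟨s, hs⟩ : ∃ s, p ^ e + 1 = 2 * s := by
    have : Odd (p ^ e) := (hp.odd_of_ne_two (by omega)).pow
    obtain ⟨m, hm⟩ := this
    exact ⟨m + 1, by omega⟩
  have hN' : ∀ a : (⊤ : Subgroup H).lowerCentralSeries 1, a ^ p ^ e = 1 := fun a =>
    Subtype.ext (hN a a.2)
  let : BaerGroup ((⊤ : Subgroup H).lowerCentralSeries 1) :=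
    BaerGroup.ofClassTwo (s := s) hc fun a b => by rw [← hs, pow_succ, hN', one_mul]
  have hq : ∀ a : (⊤ : Subgroup H).lowerCentralSeries 1, p ^ e • a = 0 := fun a => by
    rw [← natCast_zsmul, zsmul_eq_zpow, zpow_natCast, hN', zero_eq_one]
  let c : (⊤ : Subgroup H).lowerCentralSeries 1 := ⟨⁅x⁻¹, k⁻¹⁆,
    Subgroup.commutator_mem_commutator (Subgroup.mem_top _) (Subgroup.mem_top _)⟩
  have h := congrArg (Subgroup.subtype _) (prod_twisted_eq_one hp hp2
    (isLieFiltration_derivedFiltration hcl) hq (isUnipotent_derivedConj x)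
    (isUnipotent_derivedConj k⁻¹) (c := c) c.2)
  simp only [map_list_prod, List.map_map, Function.comp_def, Subgroup.subtype_apply, map_one,
    coe_derivedConj_iterate, Subgroup.val_list_prod] at h
  have h' : ∀ i : ℕ, (k ^ (i + 1).choose 2)⁻¹ * x * k ^ (i + 1).choose 2 =
      x * ((List.range ((i + 1).choose 2)).map fun r =>
        k⁻¹ ^ r * ⁅x⁻¹, k⁻¹⁆ * (k⁻¹ ^ r)⁻¹).prod := fun i => by
    rw [prod_conj_pow_eq]
    group
  simp only [h']
  rw [prod_conj_eq_conj_prod, h, hx]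
  group

end Key

/-! ### Witnesses and `J`-groups -/

section Witness

variable {G : Type*} [Group G]

/-- Passage to `⟨x, k⟩`: its derived subgroup is the normal closure of `⁅x, k⁆`, hence lies in `L`.
-/
theorem prod_conj_triangle_eq_one {x k : G}
    (hcl : (⊤ : Subgroup G).lowerCentralSeries 6 = ⊥)
    {p : ℕ} (hp : p.Prime) (hp2 : 2 < p) {e : ℕ} (hx : x ^ p ^ (e + 1) = 1)
    {L : Subgroup G} [L.Normal] (hxk : ⁅x, k⁆ ∈ L) (hL : ∀ g ∈ L, g ^ p ^ e = 1) :
    ((List.range (p ^ (e + 1))).map fun i =>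
      (k ^ (i + 1).choose 2)⁻¹ * x * k ^ (i + 1).choose 2).prod = 1 := by
  let S : Subgroup G := Subgroup.closure {x, k}
  let x' : S := ⟨x, Subgroup.subset_closure (by simp)⟩
  let k' : S := ⟨k, Subgroup.subset_closure (by simp)⟩
  have hgen : Subgroup.closure {x', k'} = ⊤ := by
    refine Subgroup.map_injective S.subtype_injective ?_
    rw [MonoidHom.map_closure, Set.image_pair, ← MonoidHom.range_eq_map, Subgroup.range_subtype]
    rfl
  have hcl' : (⊤ : Subgroup S).lowerCentralSeries 6 = ⊥ := by
    have h : S.lowerCentralSeries 6 ≤ (⊤ : Subgroup G).lowerCentralSeries 6 :=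
      Subgroup.lowerCentralSeries_mono 6 le_top
    rw [hcl, le_bot_iff, ← Subgroup.top_subtype_lowerCentralSeries] at h
    exact (Subgroup.map_eq_bot_iff_of_injective _ S.subtype_injective).1 h
  have hle : (⊤ : Subgroup S).lowerCentralSeries 1 ≤ L.subgroupOf S :=
    commutator_le_of_closure_pair hgen (L := L.subgroupOf S) hxk
  have h := prod_conj_triangle_eq_one_of_closure_pair hgen hcl' hp hp2 (e := e)
    (Subtype.ext hx) fun g hg => Subtype.ext (hL g (hle hg))
  have h2 := congrArg S.subtype h
  simpa only [map_list_prod, List.map_map, Function.comp_def, map_one, map_mul, map_inv,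
    map_pow] using! h2

theorem prod_mul_inv_pow (x k : G) (m : ℕ) :
    ((List.range m).map fun j => x * (k ^ (j + 1))⁻¹).prod =
      ((List.range m).map fun i => (k ^ (i + 1).choose 2)⁻¹ * x * k ^ (i + 1).choose 2).prod *
        (k ^ (m + 1).choose 2)⁻¹ := by
  induction m with
  | zero => simp
  | succ m ih =>
    have : (m + 1 + 1).choose 2 = (m + 1) + (m + 1).choose 2 := by
      rw [Nat.choose_succ_succ (m + 1) 1, Nat.choose_one_right]
    rw [List.range_succ, List.map_append, List.prod_append, ih, List.map_singleton,
      List.prod_singleton, List.map_append, List.prod_append, List.map_singleton,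
      List.prod_singleton, this, pow_add]
    group

theorem witnessProd_eq {k : G} {n : ℕ} (hn : Odd n) (hk : k ^ n = 1) (x : G) :
    witnessProd x k n =
      ((List.range n).map fun i => (k ^ (i + 1).choose 2)⁻¹ * x * k ^ (i + 1).choose 2).prod := by
  have h1 : witnessProd x k n = ((List.range n).map fun j => x * (k ^ (j + 1))⁻¹).prod := by
    unfold witnessProd
    congr 1
    refine List.map_congr_left fun j hj => ?_
    congr 1
    rw [eq_inv_iff_mul_eq_one, ← pow_add, Nat.sub_add_cancel (List.mem_range.1 hj), hk]
  -- For odd `n` the triangular number `n * (n + 1) / 2` is a multiple of `n`.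
  have h2 : k ^ (n + 1).choose 2 = 1 := by
    obtain ⟨m, rfl⟩ := hn
    have : (2 * m + 1 + 1).choose 2 = (2 * m + 1) * (m + 1) := by
      rw [Nat.choose_two_right, Nat.add_sub_cancel]
      have : (2 * m + 1 + 1) * (2 * m + 1) = 2 * ((2 * m + 1) * (m + 1)) := by ring
      rw [this, Nat.mul_div_cancel_left _ two_pos]
    rw [this, pow_mul, hk, one_pow]
  rw [h1, prod_mul_inv_pow, h2, inv_one, mul_one]

/-- The values of the function of a `J`-group along a coset. -/
def cosetProd (k r : G) : ℕ → G
  | 0 => 1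
  | j + 1 => r * k ^ j * cosetProd k r j

theorem cosetProd_eq_witnessProd (k r : G) (n : ℕ) : cosetProd k r n = witnessProd r k n := by
  induction n with
  | zero => simp [cosetProd, witnessProd]
  | succ n ih =>
    rw [cosetProd, ih, witnessProd, witnessProd, List.range_succ_eq_map]
    simp [Function.comp_def, Nat.succ_eq_add_one]

theorem cosetProd_mod {k r : G} (h : cosetProd k r (orderOf k) = 1) (j : ℕ) :
    cosetProd k r (j % orderOf k) = cosetProd k r j := by
  have hadd : ∀ j, cosetProd k r (j + orderOf k) = cosetProd k r j := by
    intro j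
    induction j with
    | zero => rw [zero_add, h]; rfl
    | succ j ih =>
      rw [show j + 1 + orderOf k = j + orderOf k + 1 by omega, cosetProd, cosetProd, ih, pow_add,
        pow_orderOf_eq_one, mul_one]
  induction j using Nat.strong_induction_on with
  | _ j ih =>
    rcases lt_or_ge j (orderOf k) with hj | hj
    · rw [Nat.mod_eq_of_lt hj]
    · rcases Nat.eq_zero_or_pos (orderOf k) with h0 | h0
      · rw [h0, Nat.mod_zero]
      · rw [Nat.mod_eq_sub_mod hj, ih _ (by omega), ← hadd, Nat.sub_add_cancel hj]

/-- A group with a witness is a `J`-group. -/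
theorem isJGroup_of_mem_witnesses {k : G} (hk : k ∈ witnesses G) : IsJGroup G := by
  obtain ⟨hfin, hw⟩ := hk
  have hrep : ∀ x : G, ∃ j : ℕ, x = ((x : G ⧸ Subgroup.zpowers k)).out * k ^ j := by
    intro x
    have hx : ((x : G ⧸ Subgroup.zpowers k)).out⁻¹ * x ∈ Subgroup.zpowers k := by
      rw [← QuotientGroup.eq, QuotientGroup.out_eq']
    obtain ⟨j, hj⟩ := hfin.mem_powers_iff_mem_zpowers.2 hx
    refine ⟨j, ?_⟩
    have hj' : k ^ j = ((x : G ⧸ Subgroup.zpowers k)).out⁻¹ * x := hj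
    rw [hj', mul_inv_cancel_left]
  choose J hJ using hrep
  -- With value `1` at the representative, the recursion forces `f` on its coset. The exponent `J x`
  -- is determined only modulo `orderOf k`, and `cosetProd` has that period by the witness identity.
  refine ⟨k, fun x => cosetProd k ((x : G ⧸ Subgroup.zpowers k)).out (J x), fun x => ?_⟩
  have hq : ((x * k : G) : G ⧸ Subgroup.zpowers k) = x := by
    rw [QuotientGroup.eq]
    simp
  have hP : ∀ r, cosetProd k r (orderOf k) = 1 := fun r => by
    rw [cosetProd_eq_witnessProd, hw]
  have h1 := hJ (x * k)
  have h2 := hJ x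
  simp only
  rw [hq] at h1 ⊢
  set r := ((x : G ⧸ Subgroup.zpowers k)).out
  have h3 : k ^ J (x * k) = k ^ (J x + 1) := by
    rw [pow_succ, ← mul_right_inj r, ← h1, ← mul_assoc, ← h2]
  rw [← cosetProd_mod (hP r), pow_eq_pow_iff_modEq.1 h3, cosetProd_mod (hP r), cosetProd, ← h2]

theorem IsJGroup.pi {ι : Type*} {G : ι → Type*} [∀ i, Group (G i)] (h : ∀ i, IsJGroup (G i)) :
    IsJGroup (∀ i, G i) := by
  choose k f hf using h
  exact ⟨k, fun x i => f i (x i), fun x => funext fun i => hf i (x i)⟩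

theorem IsJGroup.congr {H : Type*} [Group H] (φ : G ≃* H) (h : IsJGroup G) : IsJGroup H := by
  obtain ⟨k, f, hf⟩ := h
  refine ⟨φ k, fun y => φ (f (φ.symm y)), fun y => ?_⟩
  simp only
  rw [map_mul, φ.symm_apply_apply, hf, map_mul, φ.apply_symm_apply]

end Witness

/-! ### Finite `p`-groups and the main theorem -/

section PGroup

variable {G : Type*} [Group G]

theorem isGreatest_fullExponentIndices [Nontrivial G] [Group.IsNilpotent G] :
    ∃ d, IsGreatest (fullExponentIndices G) d := by
  have hne : (fullExponentIndices G).Nonempty :=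
    ⟨1, le_rfl, Subgroup.exponent_top⟩
  have hb : BddAbove (fullExponentIndices G) := by
    refine ⟨Group.nilpotencyClass G, fun d hd => ?_⟩
    by_contra! hlt
    have hbot : gammaSeries G d = ⊥ :=
      Subgroup.lowerCentralSeries_eq_bot_iff_nilpotencyClass_le.2 (by omega)
    have h := hd.2
    rw [hbot, Monoid.exp_eq_one_iff.2 inferInstance, eq_comm, Monoid.exp_eq_one_iff] at h
    exact not_subsingleton G h
  exact ⟨sSup _, Nat.sSup_mem hne hb, fun d hd => le_csSup hb hd⟩

/-- Since `k ∈ γ_d`, every `⁅x, k⁆` lies in `γ_{d+1}`, where maximality of `d` has cost the exponent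
at least one factor `p`. -/
theorem image_bigElements_subset_witnesses [Finite G] [Nontrivial G] {p : ℕ} (hp : p.Prime)
    (hp2 : 2 < p) (hG : IsPGroup p G) (hcl : (⊤ : Subgroup G).lowerCentralSeries 6 = ⊥) {d : ℕ}
    (hd : IsGreatest (fullExponentIndices G) d) :
    ((↑) : gammaSeries G d → G) '' bigElements (gammaSeries G d) ⊆ witnesses G := by
  rintro _ ⟨k, hk, rfl⟩
  have : Fact p.Prime := ⟨hp⟩
  obtain ⟨n, hn⟩ := hG.exists_card_eq
  obtain ⟨m, -, hm⟩ := (Nat.dvd_prime_pow hp).1 (hn ▸ Group.exponent_dvd_nat_card (G := G))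
  have hm0 : m ≠ 0 := by
    rintro rfl
    rw [pow_zero, Monoid.exp_eq_one_iff] at hm
    exact not_subsingleton G hm
  obtain ⟨e, rfl⟩ := Nat.exists_eq_succ_of_ne_zero hm0
  have hord : orderOf (k : G) = p ^ (e + 1) := by
    rw [Subgroup.orderOf_coe, hk.out, hd.1.2, hm]
  have hdvd : Monoid.exponent (gammaSeries G (d + 1)) ∣ p ^ e := by
    have h1 : Monoid.exponent (gammaSeries G (d + 1)) ∣ p ^ (e + 1) := by
      rw [← Nat.succ_eq_add_one e, ← hm]
      exact Monoid.exponent_dvd_of_monoidHom _ (gammaSeries G (d + 1)).subtype_injective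
    obtain ⟨i, hi, hi'⟩ := (Nat.dvd_prime_pow hp).1 h1
    rw [hi']
    refine pow_dvd_pow p ?_
    by_contra! hlt
    have : i = e + 1 := by omega
    subst this
    have := hd.2 (show d + 1 ∈ fullExponentIndices G from ⟨by omega, hi'.trans hm.symm⟩)
    omega
  refine ⟨isOfFinOrder_of_finite _, fun x => ?_⟩
  rw [hord, witnessProd_eq (hp.odd_of_ne_two (by omega)).pow (hord ▸ pow_orderOf_eq_one _)]
  have hd1 := hd.1.1
  have : (gammaSeries G (d + 1)).Normal := by unfold gammaSeries; infer_instance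
  refine prod_conj_triangle_eq_one hcl hp hp2 (hm ▸ Monoid.pow_exponent_eq_one x)
    (L := gammaSeries G (d + 1)) ?_ fun g hg => ?_
  · have := Subgroup.commutatorElement_mem_lowerCentralSeries (i := 0) (Subgroup.mem_top x) k.2
    rw [gammaSeries]
    rwa [show 0 + (d - 1) + 1 = d + 1 - 1 by omega] at this
  · obtain ⟨c, hc⟩ := hdvd
    have := Monoid.pow_exponent_eq_one (⟨g, hg⟩ : gammaSeries G (d + 1))
    rw [hc, pow_mul]
    rw [Subtype.ext_iff] at this
    rw [show g ^ Monoid.exponent (gammaSeries G (d + 1)) = 1 from this, one_pow]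

theorem IsPGroup.isJGroup [Finite G] {p : ℕ} (hp : p.Prime) (hp2 : 2 < p)
    (hG : IsPGroup p G) (hcl : (⊤ : Subgroup G).lowerCentralSeries 6 = ⊥) : IsJGroup G := by
  have : Fact p.Prime := ⟨hp⟩
  rcases subsingleton_or_nontrivial G with h | h
  · exact ⟨1, id, fun x => Subsingleton.elim _ _⟩
  have := hG.isNilpotent
  obtain ⟨d, hd⟩ := isGreatest_fullExponentIndices (G := G)
  obtain ⟨g, hg⟩ := Nat.Prime.exists_orderOf_eq_pow_factorization_exponent (gammaSeries G d) hp
  obtain ⟨n, hn⟩ := (hG.to_subgroup (gammaSeries G d)).exists_card_eq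
  obtain ⟨m, -, hm⟩ :=
    (Nat.dvd_prime_pow hp).1 (hn ▸ Group.exponent_dvd_nat_card (G := gammaSeries G d))
  rw [hm, Nat.Prime.factorization_pow hp, Finsupp.single_eq_same, ← hm] at hg
  exact isJGroup_of_mem_witnesses
    (image_bigElements_subset_witnesses hp hp2 hG hcl hd ⟨g, hg, rfl⟩)

end PGroup

theorem mainTheorem5 :
    (∀ p : ℕ, p.Prime → 2 < p →
      ∀ (G : Type*) [Group G] [Finite G], IsPGroup p G → Group.nilpotencyClass G ≤ 6 →
        IsJGroup G ∧
          (Nontrivial G → ∃ d : ℕ, IsGreatest (fullExponentIndices G) d ∧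
            ((↑) : gammaSeries G d → G) '' bigElements (gammaSeries G d) ⊆ witnesses G)) ∧
    (∀ (G : Type*) [Group G] [Finite G] [Group.IsNilpotent G], Odd (Nat.card G) →
      Group.nilpotencyClass G ≤ 6 → IsJGroup G) := by
  refine ⟨fun p hp hp2 G _ _ hG hcl => ?_, fun G _ _ _ hodd hcl => ?_⟩
  · have : Fact p.Prime := ⟨hp⟩
    have := hG.isNilpotent
    have h6 := Subgroup.lowerCentralSeries_eq_bot_iff_nilpotencyClass_le.2 hcl
    refine ⟨hG.isJGroup hp hp2 h6, fun _ => ?_⟩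
    obtain ⟨d, hd⟩ := isGreatest_fullExponentIndices (G := G)
    exact ⟨d, hd, image_bigElements_subset_witnesses hp hp2 hG h6 hd⟩
  -- A finite nilpotent group is the product of its Sylow subgroups, and `J`-groups are closed under
  -- products.
  · obtain ⟨φ⟩ := (Group.isNilpotent_of_finite_tfae (G := G).out 0 4).1 ‹_›
    refine (IsJGroup.pi fun p => IsJGroup.pi fun P => ?_).congr φ
    have hp : (p : ℕ).Prime := Nat.prime_of_mem_primeFactors p.2
    have hp2 : (p : ℕ) ≠ 2 := by
      intro h2
      have := Nat.dvd_of_mem_primeFactors p.2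
      rw [h2] at this
      exact (Nat.not_even_iff_odd.2 hodd) (even_iff_two_dvd.2 this)
    exact P.isPGroup'.isJGroup hp (lt_of_le_of_ne hp.two_le hp2.symm)
      (Subgroup.lowerCentralSeries_eq_bot_iff_nilpotencyClass_le.2
        ((Subgroup.nilpotencyClass_le (P : Subgroup G)).trans hcl))
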